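/- Let $d,T\in\mathbb N$ and let $(\Omega,\mathscr F,(\mathscr F_t)_{t=0,\dots,T},\mathbb P)$ be a filtered probability space such that every $\mathscr F_t$ contains all $\mathbb P$-null sets. Let $\mathscr S$ be a family of adapted $\mathbb R^d$-valued processes $S=(S_t)_{t=0,\dots,T}$ (the possible discounted prices), and put $\Delta S_t=S_t-S_{t-1}$. A portfolio is a process $\varphi=(\varphi_1,\dots,\varphi_T)$ with $\varphi_t$ an $\mathscr F_{t-1}$-measurable $\mathbb R^d$-valued random variable; its wealth in the model $S$ from initial capital $x\in\mathbb R$ is $W^S_t(x,\varphi)=x+\sum_{s=1}^t\langle\varphi_s,\Delta S_s\rangle$. Let $\mathscr L(x,S)$ be the set of portfolios with $W^S_t(x,\varphi)\ge 0$ $\mathbb P$-a.s. for all $t\in\{0,\dots,T\}$, and let $\mathscr A(x)=\bigcap_{S\in\mathscr S}\mathscr L(x,S)$ be the set of admissible portfolios. For $S\in\mathscr S$ and $t\in\{1,\dots,T\}$ let $D^S_t(\omega)$ be the smallest affine subset of $\mathbb R^d$ containing the support of the regular conditional distribution of $\Delta S_t$ given $\mathscr F_{t-1}$ at $\omega$.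 Let $x>0$ and assume that there is $S^*\in\mathscr S$ such that (a) for every $\varphi\in\mathscr L(x,S^*)$, if $W^{S^*}_T(0,\varphi)\ge 0$ $\mathbb P$-a.s., then $W^{S^*}_T(0,\varphi)=0$ $\mathbb P$-a.s.; (b) for every $S\in\mathscr S$ and every $t\in\{1,\dots,T\}$, $D^S_t\subseteq D^{S^*}_t$ $\mathbb P$-a.s. Let $U:\mathbb R\to\mathbb R\cup\{-\infty\}$ be non-decreasing, concave and upper semicontinuous, such that the interior of $\{y\in\mathbb R: U(y)>-\infty\}$ is $(0,+\infty)$ and $\lim_{y\to+\infty}U(y)<+\infty$. With the convention $+\infty-\infty=-\infty$ for expectations, put $$u(x)=\sup_{\varphi\in\mathscr A(x)}\ \inf_{S\in\mathscr S}\ \mathbb E_{\mathbb P}\big[U\big(W^S_T(x,\varphi)\big)\big].$$ Then there is $\varphi^*\in\mathscr A(x)$ with $$u(x)=\inf_{S\in\mathscr S}\mathbb E_{\mathbb P}\big[U\big(W^S_T(x,\varphi^*)\big)\big],$$ and $-\infty<u(x)<+\infty$. -/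

import Mathlib

open MeasureTheory ProbabilityTheory Filter Topology Set
open scoped ENNReal

noncomputable section

namespace RobustUtility

/-- A utility function on the real line with values in `ℝ ∪ {-∞}`:
non-decreasing, concave and upper semicontinuous. -/
structure IsUtility (U : ℝ → EReal) : Prop where
  ne_top : ∀ x, U x ≠ ⊤
  mono : Monotone U
  concave : ∀ x y a b : ℝ, 0 < a → 0 < b → a + b = 1 →
    (a : EReal) * U x + (b : EReal) * U y ≤ U (a * x + b * y)
  usc : UpperSemicontinuous U

/-- The effective domain of a utility function. -/
def effDom (U : ℝ → EReal) : Set ℝ := {x | ⊥ < U x}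

/-- Price processes: `d` assets, times `0, 1, …, T`. -/
abbrev PriceProcess (Ω : Type*) (d T : ℕ) := Fin (T + 1) → Ω → EuclideanSpace ℝ (Fin d)

/-- Portfolio processes; the index `s : Fin T` stands for the trading period
from time `s` to time `s + 1`. -/
abbrev Portfolio (Ω : Type*) (d T : ℕ) := Fin T → Ω → EuclideanSpace ℝ (Fin d)

variable {Ω : Type*} {d T : ℕ}

/-- The price change over the trading period from time `s` to time `s + 1`. -/
def increment (S : PriceProcess Ω d T) (s : Fin T) (ω : Ω) : EuclideanSpace ℝ (Fin d) :=
  S s.succ ω - S s.castSucc ω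

/-- The wealth at time `t` of the self-financing portfolio `φ` started from capital `x`. -/
def wealth (S : PriceProcess Ω d T) (x : ℝ) (φ : Portfolio Ω d T) (t : Fin (T + 1)) (ω : Ω) : ℝ :=
  x + ∑ s : Fin T with s.castSucc < t, inner ℝ (φ s ω) (increment S s ω)

variable [mΩ : MeasurableSpace Ω]

/-- Portfolios are predictable: the position held from time `s` to time `s + 1`
is measurable with respect to the information at time `s`. -/
def IsPredictable (ℱ : Filtration (Fin (T + 1)) mΩ) (φ : Portfolio Ω d T) : Prop :=
  ∀ s : Fin T, Measurable[ℱ s.castSucc] (φ s)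

/-- The portfolios whose wealth never becomes negative in the single model `S`. -/
def feasible (P : Measure Ω) (ℱ : Filtration (Fin (T + 1)) mΩ) (x : ℝ)
    (S : PriceProcess Ω d T) : Set (Portfolio Ω d T) :=
  {φ | IsPredictable ℱ φ ∧ ∀ t : Fin (T + 1), ∀ᵐ ω ∂P, 0 ≤ wealth S x φ t ω}

/-- The admissible portfolios: those that are feasible in all models of the family. -/
def admissible (P : Measure Ω) (ℱ : Filtration (Fin (T + 1)) mΩ) (𝒮 : Set (PriceProcess Ω d T))
    (x : ℝ) : Set (Portfolio Ω d T) :=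
  ⋂ S ∈ 𝒮, feasible P ℱ x S

/-- Expectation of an extended real random variable, with the convention `∞ - ∞ = -∞`
(which is the convention of subtraction in `EReal`). -/
def expectation (P : Measure Ω) (X : Ω → EReal) : EReal :=
  ((∫⁻ ω, (X ω).toENNReal ∂P : ℝ≥0∞) : EReal) - ((∫⁻ ω, (-X ω).toENNReal ∂P : ℝ≥0∞) : EReal)

/-- The worst-case expected utility of terminal wealth over the family of models. -/
def worstCaseUtility (P : Measure Ω) (𝒮 : Set (PriceProcess Ω d T)) (U : ℝ → EReal) (x : ℝ)
    (φ : Portfolio Ω d T) : EReal :=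
  ⨅ S ∈ 𝒮, expectation P fun ω => U (wealth S x φ (Fin.last T) ω)

/-- The robust value function. -/
def robustValue (P : Measure Ω) (ℱ : Filtration (Fin (T + 1)) mΩ) (𝒮 : Set (PriceProcess Ω d T))
    (U : ℝ → EReal) (x : ℝ) : EReal :=
  ⨆ φ ∈ admissible P ℱ 𝒮 x, worstCaseUtility P 𝒮 U x φ

/-- A regular conditional distribution, given the sub-σ-algebra `m`, of the random vector `Y`:
the regular conditional distribution of `Y` given the identity map from `Ω` to `(Ω, m)`. -/
def condLaw (P : Measure Ω) [IsFiniteMeasure P] (m : MeasurableSpace Ω)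
    (Y : Ω → EuclideanSpace ℝ (Fin d)) : @Kernel Ω (EuclideanSpace ℝ (Fin d)) m _ :=
  @condDistrib Ω Ω (EuclideanSpace ℝ (Fin d)) _ _ _ mΩ m Y id P _

/-- The smallest affine subspace containing the support of the conditional distribution
of the price change from time `s` to time `s + 1`, given the information at time `s`. -/
def condAffineSupport (P : Measure Ω) [IsFiniteMeasure P] (ℱ : Filtration (Fin (T + 1)) mΩ)
    (S : PriceProcess Ω d T) (s : Fin T) (ω : Ω) :
    AffineSubspace ℝ (EuclideanSpace ℝ (Fin d)) :=
  affineSpan ℝ (condLaw P (ℱ s.castSucc) (increment S s) ω).support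

/-- Absence of arbitrage in the single model `S`, among the portfolios that are feasible
from the initial capital `x`. -/
def NoArbitrage (P : Measure Ω) (ℱ : Filtration (Fin (T + 1)) mΩ) (x : ℝ)
    (S : PriceProcess Ω d T) : Prop :=
  ∀ φ ∈ feasible P ℱ x S, (∀ᵐ ω ∂P, 0 ≤ wealth S 0 φ (Fin.last T) ω) →
    ∀ᵐ ω ∂P, wealth S 0 φ (Fin.last T) ω = 0

/-- The models in the family that are free of arbitrage and for which redundancy of assets
entails redundancy in every other model. -/
def arbitrageFreeModels (P : Measure Ω) [IsFiniteMeasure P] (ℱ : Filtration (Fin (T + 1)) mΩ)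
    (𝒮 : Set (PriceProcess Ω d T)) (x : ℝ) : Set (PriceProcess Ω d T) :=
  {S' ∈ 𝒮 | NoArbitrage P ℱ x S' ∧ ∀ S ∈ 𝒮, ∀ s : Fin T,
    ∀ᵐ ω ∂P, condAffineSupport P ℱ S s ω ≤ condAffineSupport P ℱ S' s ω}

end RobustUtility

end

/-! Fix a real `L ≥ 0` above `U`. Maximising worst-case utility is minimising the supremum over
models of the expected loss `L - U`, which is nonnegative, convex and lower semicontinuous in
wealth. Its sublevel sets at levels decreasing to the infimum are convex, nested and nonempty. Given
an almost surely convergent selection from them, the limit is a minimiser by Fatou's lemma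
(`IsUtility.mem_admissible_of_tendsto`).

Convergence fails only if positions blow up. In the arbitrage-free model, split off the redundant
part of each position (`exists_mem_annihilator_orthogonal`). If the rest were unbounded while its
payoff stays bounded below, a limit of normalised positions would be a nonzero one-step arbitrage or
a redundancy (`ae_bounded_of_payoff_bounded`). Bounded positions have almost surely convergent tail
convex combinations, and one proceeds period by period (`exists_ae_tendsto_selection`). The
inclusion of affine supports makes a redundancy in that model one in every model
(`annihilator_subset_of_affineSpan_support_le`), so removing it costs nothing. The zero portfolio
makes the value finite. -/

namespace RobustUtility

/-! ### Convergence of tail convex combinations -/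

/-- The finitely supported convex weights on `ℕ` that vanish before `n`. -/
def tailWeights (n : ℕ) : Set (ℕ →₀ ℝ) :=
  {w | (∀ k, 0 ≤ w k) ∧ (∀ k < n, w k = 0) ∧ (w.sum fun _ a => a) = 1}

lemma single_mem_tailWeights (n : ℕ) : Finsupp.single n (1 : ℝ) ∈ tailWeights n := by
  refine ⟨fun k => ?_, fun k hk => ?_, by simp⟩
  · rw [Finsupp.single_apply]; split_ifs <;> norm_num
  · rw [Finsupp.single_apply, if_neg hk.ne']

lemma tailWeights_anti {n k : ℕ} (h : n ≤ k) : tailWeights k ⊆ tailWeights n :=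
  fun _ hw => ⟨hw.1, fun j hj => hw.2.1 j (hj.trans_le h), hw.2.2⟩

lemma convex_tailWeights (n : ℕ) : Convex ℝ (tailWeights n) := by
  intro v hv w hw a b ha hb hab
  refine ⟨fun k => ?_, fun k hk => ?_, ?_⟩
  · simpa using add_nonneg (mul_nonneg ha (hv.1 k)) (mul_nonneg hb (hw.1 k))
  · simp [hv.2.1 k hk, hw.2.1 k hk]
  · have hsum : ∀ w : ℕ →₀ ℝ,
        (w.sum fun _ a => a) = Finsupp.linearCombination ℝ (fun _ => (1 : ℝ)) w := by
      intro w; simp [Finsupp.linearCombination_apply]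
    have h1 := hv.2.2
    have h2 := hw.2.2
    rw [hsum] at h1 h2 ⊢
    rw [map_add, map_smul, map_smul, h1, h2]
    simpa using hab

lemma linearCombination_mem_of_tailWeights {V : Type*} [AddCommGroup V] [Module ℝ V] {K : Set V}
    (hK : Convex ℝ K) {x : ℕ → V} {n : ℕ} (hx : ∀ k, n ≤ k → x k ∈ K) {w : ℕ →₀ ℝ}
    (hw : w ∈ tailWeights n) : Finsupp.linearCombination ℝ x w ∈ K := by
  rw [Finsupp.linearCombination_apply, Finsupp.sum]
  refine hK.sum_mem (fun k _ => hw.1 k) hw.2.2 fun k hk => hx k ?_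
  by_contra h
  exact Finsupp.mem_support_iff.1 hk (hw.2.1 k (not_le.1 h))

lemma tendsto_linearCombination_tailWeights {V : Type*} [NormedAddCommGroup V] [NormedSpace ℝ V]
    {x : ℕ → V} {l : V} (hx : Tendsto x atTop (𝓝 l)) {w : ℕ → ℕ →₀ ℝ}
    (hw : ∀ n, w n ∈ tailWeights n) :
    Tendsto (fun n => Finsupp.linearCombination ℝ x (w n)) atTop (𝓝 l) := by
  rw [Metric.tendsto_atTop] at hx ⊢
  intro ε hε
  obtain ⟨N, hN⟩ := hx ε hε
  exact ⟨N, fun n hn => Metric.mem_ball.1 <| linearCombination_mem_of_tailWeights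
    (convex_ball l ε) (fun k hk => Metric.mem_ball.2 (hN k (hn.trans hk))) (hw n)⟩

/-- A bounded sequence in an inner product space has tail convex combinations that form
a Cauchy sequence. -/
lemma exists_tailWeights_cauchySeq {H : Type*} [NormedAddCommGroup H] [InnerProductSpace ℝ H]
    {x : ℕ → H} {C : ℝ} (hx : ∀ k, ‖x k‖ ≤ C) :
    ∃ w : ℕ → ℕ →₀ ℝ, (∀ n, w n ∈ tailWeights n) ∧
      CauchySeq fun n => Finsupp.linearCombination ℝ x (w n) := by
  set L := Finsupp.linearCombination ℝ x
  set A : ℕ → Set ℝ := fun n => (fun w => ‖L w‖) '' tailWeights n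
  have hbdd : ∀ n, BddBelow (A n) := fun n => ⟨0, by rintro _ ⟨w, -, rfl⟩; exact norm_nonneg _⟩
  have hne : ∀ n, (A n).Nonempty := fun n => ⟨_, _, single_mem_tailWeights n, rfl⟩
  set r : ℕ → ℝ := fun n => sInf (A n)
  have hr0 : ∀ n, 0 ≤ r n := fun n =>
    le_csInf (hne n) (by rintro _ ⟨w, -, rfl⟩; exact norm_nonneg _)
  have hmono : Monotone r := fun n k h =>
    csInf_le_csInf (hbdd n) (hne k) (image_mono (tailWeights_anti h))
  have hrC : ∀ n, r n ≤ C := fun n => by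
    refine (csInf_le (hbdd n) ⟨_, single_mem_tailWeights n, rfl⟩).trans ?_
    simpa [L] using hx n
  have hbr : BddAbove (range r) := ⟨C, by rintro _ ⟨n, rfl⟩; exact hrC n⟩
  set D := ⨆ n, r n
  have hlim : Tendsto r atTop (𝓝 D) := tendsto_atTop_ciSup hmono hbr
  have hrD : ∀ n, r n ≤ D := le_ciSup hbr
  have hex : ∀ n : ℕ, ∃ w ∈ tailWeights n, ‖L w‖ < r n + 1 / ((n : ℝ) + 1) := fun n => by
    obtain ⟨_, ⟨w, hw, rfl⟩, h⟩ := exists_lt_of_csInf_lt (hne n)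
      (lt_add_of_pos_right (r n) (Nat.one_div_pos_of_nat (α := ℝ) (n := n)))
    exact ⟨w, hw, h⟩
  choose w hw hwr using hex
  refine ⟨w, hw, ?_⟩
  have hb : ∀ N k : ℕ, N ≤ k → ‖L (w k)‖ ≤ D + 1 / ((N : ℝ) + 1) := fun N k h =>
    (hwr k).le.trans (add_le_add (hrD k) (Nat.one_div_le_one_div h))
  -- The `w n` nearly minimise the norm over tail convex combinations, and the minima `r n` increase
  -- to `D`. Midpoints of later terms have norm at least `r N`, so the parallelogram law bounds
  -- their distance by this square root.
  refine cauchySeq_of_le_tendsto_0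
    (fun N => √(4 * (D + 1 / ((N : ℝ) + 1)) ^ 2 - 4 * r N ^ 2)) (fun n k N hn hk => ?_) ?_
  · rw [dist_eq_norm]
    refine Real.le_sqrt_of_sq_le ?_
    have hpar := parallelogram_law_with_norm ℝ (L (w n)) (L (w k))
    have hmid : r N ≤ ‖L ((1 / 2 : ℝ) • w n + (1 / 2 : ℝ) • w k)‖ :=
      csInf_le (hbdd N) ⟨_, convex_tailWeights N (tailWeights_anti hn (hw n))
        (tailWeights_anti hk (hw k)) (by norm_num) (by norm_num) (by norm_num), rfl⟩
    rw [map_add, map_smul, map_smul, ← smul_add, norm_smul] at hmid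
    have h2 : 2 * r N ≤ ‖L (w n) + L (w k)‖ := by
      rw [Real.norm_of_nonneg (by norm_num : (0 : ℝ) ≤ 1 / 2)] at hmid; linarith
    have h3 := mul_self_le_mul_self (by linarith [hr0 N]) h2
    have h4 := mul_self_le_mul_self (norm_nonneg _) (hb N n hn)
    have h5 := mul_self_le_mul_self (norm_nonneg _) (hb N k hk)
    nlinarith
  · have h1 : Tendsto (fun N : ℕ => 4 * (D + 1 / ((N : ℝ) + 1)) ^ 2 - 4 * r N ^ 2) atTop
        (𝓝 (4 * (D + 0) ^ 2 - 4 * D ^ 2)) :=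
      (((tendsto_const_nhds.add tendsto_one_div_add_atTop_nhds_zero_nat).pow 2).const_mul 4).sub
        ((hlim.pow 2).const_mul 4)
    simpa using h1.sqrt

variable {Ω : Type*}

lemma linearCombination_apply_fun {ι V : Type*} [AddCommGroup V] [Module ℝ V]
    (f : ℕ → ι → V) (w : ℕ →₀ ℝ) (i : ι) :
    Finsupp.linearCombination ℝ f w i = Finsupp.linearCombination ℝ (fun k => f k i) w := by
  simp [Finsupp.linearCombination_apply, Finsupp.sum, Finset.sum_apply]

/-- A pointwise bounded sequence of random vectors has tail convex combinations that
converge almost surely. -/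
lemma exists_tailWeights_ae_tendsto [MeasurableSpace Ω] {P : Measure Ω} [IsFiniteMeasure P]
    {H : Type*} [NormedAddCommGroup H] [InnerProductSpace ℝ H] [CompleteSpace H]
    {f : ℕ → Ω → H} (hf : ∀ k, AEStronglyMeasurable (f k) P)
    (hb : ∀ᵐ ω ∂P, ∃ R : ℝ, ∀ k, ‖f k ω‖ ≤ R) :
    ∃ w : ℕ → ℕ →₀ ℝ, (∀ n, w n ∈ tailWeights n) ∧ ∀ᵐ ω ∂P, ∃ l,
      Tendsto (fun n => Finsupp.linearCombination ℝ (fun k => f k ω) (w n)) atTop (𝓝 l) := by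
  -- The weight brings the whole sequence into the unit ball, hence into a bounded set of `L²`. It
  -- does not depend on `k`, so it commutes with convex combinations and can be divided out at the
  -- end.
  set ρ : Ω → ℝ := fun ω => (1 + (⨆ k, ‖f k ω‖ₑ).toReal)⁻¹
  have hρpos : ∀ ω, 0 < ρ ω := fun ω => by positivity
  have hρm : AEMeasurable ρ P :=
    ((AEMeasurable.iSup fun k => (hf k).enorm).ennreal_toReal.const_add 1).inv
  have hle : ∀ᵐ ω ∂P, ∀ k, ‖ρ ω • f k ω‖ ≤ 1 := by
    filter_upwards [hb] with ω ⟨R, hR⟩ k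
    have hfin : (⨆ k, ‖f k ω‖ₑ) ≠ ⊤ := by
      refine ne_top_of_le_ne_top (ENNReal.ofReal_ne_top (r := R)) (iSup_le fun k => ?_)
      rw [← ofReal_norm]; exact ENNReal.ofReal_le_ofReal (hR k)
    have h1 : ‖f k ω‖ ≤ (⨆ k, ‖f k ω‖ₑ).toReal := by
      rw [← toReal_enorm]; exact ENNReal.toReal_mono hfin (le_iSup (fun k => ‖f k ω‖ₑ) k)
    rw [norm_smul, Real.norm_of_nonneg (hρpos ω).le, inv_mul_le_one₀ (by positivity)]
    linarith
  have hmem : ∀ k, MemLp (fun ω => ρ ω • f k ω) 2 P := fun k =>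
    MemLp.of_bound (hρm.aestronglyMeasurable.smul (hf k)) 1 (hle.mono fun ω h => h k)
  set F : ℕ → Lp H 2 P := fun k => (hmem k).toLp
  have hF : ∀ᵐ ω ∂P, ∀ k, F k ω = ρ ω • f k ω := ae_all_iff.2 fun k => (hmem k).coeFn_toLp
  obtain ⟨C, hC⟩ : ∃ C : ℝ, ∀ k, ‖F k‖ ≤ C := by
    refine ⟨_, fun k => Lp.norm_le_of_ae_bound (C := 1) zero_le_one ?_⟩
    filter_upwards [hF, hle] with ω h1 h2
    rw [h1]; exact h2 k
  obtain ⟨w, hw, hcau⟩ := exists_tailWeights_cauchySeq hC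
  obtain ⟨g, hg⟩ := cauchySeq_tendsto_of_complete hcau
  obtain ⟨ns, hns, hae⟩ := (tendstoInMeasure_of_tendsto_Lp hg).exists_seq_tendsto_ae
  refine ⟨fun n => w (ns n), fun n => tailWeights_anti (hns.id_le n) (hw _), ?_⟩
  have hlc : ∀ᵐ ω ∂P, ∀ n, (Finsupp.linearCombination ℝ F (w n)) ω
      = Finsupp.linearCombination ℝ (fun k => F k ω) (w n) := by
    refine ae_all_iff.2 fun n => ?_
    induction w n using Finsupp.induction_linear with
    | zero =>
      filter_upwards [Lp.coeFn_zero H 2 P] with ω h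
      rw [map_zero, map_zero, h, Pi.zero_apply]
    | add v v' h h' =>
      rw [map_add]
      filter_upwards [h, h', Lp.coeFn_add (Finsupp.linearCombination ℝ F v)
        (Finsupp.linearCombination ℝ F v')] with ω h h' h''
      rw [h'', Pi.add_apply, h, h', map_add]
    | single k a =>
      rw [Finsupp.linearCombination_single]
      filter_upwards [Lp.coeFn_smul a (F k)] with ω h
      rw [h, Finsupp.linearCombination_single, Pi.smul_apply]
  filter_upwards [hlc, hF, hae] with ω h1 h2 h3
  refine ⟨(ρ ω)⁻¹ • g ω, ?_⟩
  have h4 := h3.const_smul (ρ ω)⁻¹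
  refine h4.congr fun n => ?_
  rw [h1]
  simp_rw [h2, Finsupp.linearCombination_apply, Finsupp.sum, Finset.smul_sum]
  refine Finset.sum_congr rfl fun k _ => ?_
  rw [smul_comm (w (ns n) k), inv_smul_smul₀ (hρpos ω).ne']

end RobustUtility

/-! ### One trading period: redundant positions and boundedness -/

namespace RobustUtility

variable {Ω : Type*}

section OneStep

variable {m m0 : MeasurableSpace Ω} {P : Measure Ω} {d : ℕ}

/-- The `m`-measurable random vectors that are almost surely orthogonal to `Y`. -/
def annihilator (P : Measure[m0] Ω) (m : MeasurableSpace Ω) (Y : Ω → EuclideanSpace ℝ (Fin d)) :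
    Set (Ω → EuclideanSpace ℝ (Fin d)) :=
  {ν | Measurable[m] ν ∧ ∀ᵐ ω ∂P, inner ℝ (ν ω) (Y ω) = 0}

/-- Completeness of `m` is what lets almost sure statements descend to the restricted measure;
limits can then be chosen `m`-measurable, as predictability demands. -/
lemma ae_trim_of_ae (hm : m ≤ m0) (hnull : ∀ A : Set Ω, P A = 0 → MeasurableSet[m] A)
    {p : Ω → Prop} (h : ∀ᵐ ω ∂P, p ω) : ∀ᵐ ω ∂P.trim hm, p ω := by
  rw [ae_iff] at h ⊢
  rwa [trim_measurableSet_eq hm (hnull _ h)]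

lemma exists_measurable_limit (hm : m ≤ m0) (hnull : ∀ A : Set Ω, P A = 0 → MeasurableSet[m] A)
    {h : ℕ → Ω → EuclideanSpace ℝ (Fin d)} (hh : ∀ n, Measurable[m] (h n))
    (hl : ∀ᵐ ω ∂P, ∃ l, Tendsto (fun n => h n ω) atTop (𝓝 l)) :
    ∃ g, Measurable[m] g ∧ ∀ᵐ ω ∂P, Tendsto (fun n => h n ω) atTop (𝓝 (g ω)) := by
  obtain ⟨g, hg, hlim⟩ := @measurable_limit_of_tendsto_metrizable_ae Ω _ m _ _ _ _ ℕ _ (P.trim hm) h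
    atTop _ (fun n => (hh n).aemeasurable) (ae_trim_of_ae hm hnull hl)
  exact ⟨g, hg, ae_of_ae_trim hm hlim⟩

lemma measurable_linearCombination {V : Type*} [NormedAddCommGroup V] [NormedSpace ℝ V]
    [MeasurableSpace V] [BorelSpace V] [SecondCountableTopology V]
    {f : ℕ → Ω → V} (hf : ∀ k, Measurable[m] (f k)) (w : ℕ →₀ ℝ) :
    Measurable[m] fun ω => Finsupp.linearCombination ℝ (fun k => f k ω) w := by
  simp_rw [Finsupp.linearCombination_apply, Finsupp.sum]
  exact Finset.measurable_sum _ fun k _ => (hf k).const_smul (w k)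

/-- Every `m`-measurable random vector is the sum of an element of the annihilator and of
a vector that is pointwise orthogonal to the annihilator. -/
lemma exists_mem_annihilator_orthogonal [IsFiniteMeasure P] (hm : m ≤ m0)
    (Y : Ω → EuclideanSpace ℝ (Fin d))
    {φ : Ω → EuclideanSpace ℝ (Fin d)} (hφ : Measurable[m] φ) :
    ∃ ν ∈ annihilator P m Y, ∀ ν' ∈ annihilator P m Y,
      ∀ᵐ ω ∂P, inner ℝ (φ ω - ν ω) (ν' ω) = 0 := by
  set Q := P.trim hm
  let N : Submodule ℝ (Lp (EuclideanSpace ℝ (Fin d)) 2 Q) :=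
    { carrier := {f | ∀ᵐ ω ∂P, inner ℝ (f ω) (Y ω) = 0}
      zero_mem' := by
        filter_upwards [ae_of_ae_trim hm (Lp.coeFn_zero (EuclideanSpace ℝ (Fin d)) 2 Q)] with ω h
        rw [h, Pi.zero_apply, inner_zero_left]
      add_mem' := by
        intro f g hf hg
        filter_upwards [hf, hg, ae_of_ae_trim hm (Lp.coeFn_add f g)] with ω h1 h2 h3
        rw [h3, Pi.add_apply, inner_add_left, h1, h2, add_zero]
      smul_mem' := by
        intro c f hf
        filter_upwards [hf, ae_of_ae_trim hm (Lp.coeFn_smul c f)] with ω h1 h2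
        rw [h2, Pi.smul_apply, inner_smul_left, h1, mul_zero] }
  have hclosed : IsClosed (N : Set (Lp (EuclideanSpace ℝ (Fin d)) 2 Q)) := by
    refine IsSeqClosed.isClosed fun f g hf hfg => ?_
    obtain ⟨ns, -, hae⟩ := (tendstoInMeasure_of_tendsto_Lp hfg).exists_seq_tendsto_ae
    have hf' : ∀ᵐ ω ∂P, ∀ n, inner ℝ (f n ω) (Y ω) = 0 := ae_all_iff.2 hf
    filter_upwards [hf', ae_of_ae_trim hm hae] with ω h1 h2
    refine tendsto_nhds_unique (h2.inner tendsto_const_nhds) ?_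
    simp [h1]
  have : CompleteSpace N := hclosed.completeSpace_coe
  -- Dividing by `1 + ‖φ‖` gives a bounded vector that can be projected in `L²`. The annihilator is
  -- stable under `m`-measurable scalars, so the projection can be scaled back.
  set a : Ω → ℝ := fun ω => 1 + ‖φ ω‖
  have ha : ∀ ω, 0 < a ω := fun ω => by positivity
  have ham : Measurable[m] a := (measurable_norm.comp hφ).const_add 1
  set φ₁ : Ω → (EuclideanSpace ℝ (Fin d)) := fun ω => (a ω)⁻¹ • φ ω
  have hφ₁ : Measurable[m] φ₁ := ham.inv.smul hφ
  have hL : MemLp φ₁ 2 Q := by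
    refine MemLp.of_bound hφ₁.aestronglyMeasurable 1 (ae_of_all _ fun ω => ?_)
    rw [norm_smul, Real.norm_of_nonneg (inv_nonneg.2 (ha ω).le), inv_mul_le_one₀ (ha ω)]
    simp [a]
  set p : Lp (EuclideanSpace ℝ (Fin d)) 2 Q := N.starProjection hL.toLp
  have hpN : p ∈ N := N.starProjection_apply_mem _
  have hpm : Measurable[m] p := (Lp.stronglyMeasurable p).measurable
  have haφ : ∀ ω, φ ω = a ω • φ₁ ω := fun ω => by simp [φ₁, smul_smul, (ha ω).ne']
  refine ⟨fun ω => a ω • p ω, ⟨ham.smul hpm, ?_⟩, fun ν' hν' => ?_⟩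
  · filter_upwards [hpN] with ω h
    rw [inner_smul_left, h, mul_zero]
  set q : Ω → ℝ := fun ω => inner ℝ (φ₁ ω - p ω) (ν' ω)
  have hqm : Measurable[m] q := Measurable.inner (hφ₁.sub hpm) hν'.1
  -- Testing against `b • ν'` makes orthogonality pointwise: `b` has the sign of `q`, so `b * q ≥ 0`
  -- has integral zero and hence vanishes. The denominators keep `b • ν'` bounded.
  set b : Ω → ℝ := fun ω => q ω / (1 + |q ω|) * (1 + ‖ν' ω‖)⁻¹
  have hbm : Measurable[m] b :=
    (hqm.div ((measurable_norm.comp hqm).const_add 1)).mul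
      (((measurable_norm.comp hν'.1).const_add 1).inv)
  have hb : MemLp (fun ω => b ω • ν' ω) 2 Q := by
    refine MemLp.of_bound (hbm.smul hν'.1).aestronglyMeasurable 1 (ae_of_all _ fun ω => ?_)
    rw [norm_smul, norm_mul, norm_div, Real.norm_of_nonneg (by positivity : 0 ≤ 1 + |q ω|),
      Real.norm_of_nonneg (by positivity : 0 ≤ (1 + ‖ν' ω‖)⁻¹), mul_assoc]
    refine mul_le_one₀ ?_ (by positivity) ?_
    · rw [div_le_one (by positivity), Real.norm_eq_abs]; linarith
    · rw [inv_mul_le_one₀ (by positivity)]; linarith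
  have hbN : hb.toLp ∈ N := by
    filter_upwards [ae_of_ae_trim hm hb.coeFn_toLp, hν'.2] with ω h1 h2
    rw [h1, inner_smul_left, h2, mul_zero]
  have horth : inner ℝ (hL.toLp - p) hb.toLp = 0 :=
    N.starProjection_inner_eq_zero _ _ hbN
  rw [L2.inner_def] at horth
  have hnn : 0 ≤ᵐ[Q] fun ω => 
      inner ℝ ((hL.toLp - p : Lp (EuclideanSpace ℝ (Fin d)) 2 Q) ω)
        ((hb.toLp : Lp (EuclideanSpace ℝ (Fin d)) 2 Q) ω) := by
    filter_upwards [Lp.coeFn_sub hL.toLp p, hL.coeFn_toLp, hb.coeFn_toLp] with ω h1 h2 h3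
    rw [h1, Pi.sub_apply, h2, h3, inner_smul_right]
    have : 0 ≤ q ω * q ω := mul_self_nonneg _
    have e : b ω * q ω = q ω * q ω * ((1 + |q ω|)⁻¹ * (1 + ‖ν' ω‖)⁻¹) := by
      simp only [b]; ring
    show 0 ≤ b ω * q ω
    rw [e]; positivity
  rw [integral_eq_zero_iff_of_nonneg_ae hnn (L2.integrable_inner _ _)] at horth
  filter_upwards [ae_of_ae_trim hm horth, ae_of_ae_trim hm (Lp.coeFn_sub hL.toLp p),
    ae_of_ae_trim hm hL.coeFn_toLp, ae_of_ae_trim hm hb.coeFn_toLp] with ω h0 h1 h2 h3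
  rw [h1, Pi.sub_apply, h2, h3, inner_smul_right] at h0
  have h0' : b ω * q ω = 0 := h0
  have hq : q ω = 0 := by
    rcases mul_eq_zero.1 h0' with h | h
    · have h5 : (1 + ‖ν' ω‖)⁻¹ ≠ 0 := by positivity
      have h6 : 1 + |q ω| ≠ 0 := by positivity
      simpa [b, h5, h6] using h
    · exact h
  rw [haφ, ← smul_sub, inner_smul_left]
  show _ * q ω = 0
  rw [hq, mul_zero]

/-- If `Y` admits no one-step arbitrage, positions orthogonal to the annihilator of `Y` whose
payoffs are pointwise bounded below are pointwise bounded. -/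
lemma ae_bounded_of_payoff_bounded [IsFiniteMeasure P] (hm : m ≤ m0)
    (hnull : ∀ A : Set Ω, P A = 0 → MeasurableSet[m] A) {Y : Ω → EuclideanSpace ℝ (Fin d)}
    (hNA : ∀ ξ : Ω → EuclideanSpace ℝ (Fin d), Measurable[m] ξ →
      (∀ᵐ ω ∂P, 0 ≤ inner ℝ (ξ ω) (Y ω)) → ∀ᵐ ω ∂P, inner ℝ (ξ ω) (Y ω) = 0)
    {ψ : ℕ → Ω → EuclideanSpace ℝ (Fin d)} (hψ : ∀ n, Measurable[m] (ψ n))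
    (horth : ∀ n, ∀ ν ∈ annihilator P m Y, ∀ᵐ ω ∂P, inner ℝ (ψ n ω) (ν ω) = 0)
    (hb : ∀ᵐ ω ∂P, ∃ c : ℝ, ∀ n, -c ≤ inner ℝ (ψ n ω) (Y ω)) :
    ∀ᵐ ω ∂P, ∃ R : ℝ, ∀ n, ‖ψ n ω‖ ≤ R := by
  classical
  set B : Set Ω := {ω | ∀ N : ℕ, ∃ k, (N : ℝ) ≤ ‖ψ k ω‖}
  have hBm : MeasurableSet[m] B := by
    have : B = ⋂ N : ℕ, ⋃ k, {ω | (N : ℝ) ≤ ‖ψ k ω‖} := by ext; simp [B]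
    rw [this]
    exact MeasurableSet.iInter fun N => MeasurableSet.iUnion fun k =>
      measurableSet_le measurable_const (measurable_norm.comp (hψ k))
  -- The alternative `ω ∉ B` makes the first-passage index `τ` total; its value off `B` is
  -- irrelevant.
  have hex : ∀ (n : ℕ) (ω : Ω), ∃ k, ((n + 1 : ℕ) : ℝ) ≤ ‖ψ k ω‖ ∨ ω ∉ B := by
    intro n ω
    by_cases h : ω ∈ B
    · exact (h (n + 1)).imp fun k hk => Or.inl hk
    · exact ⟨0, Or.inr h⟩
  set τ : ℕ → Ω → ℕ := fun n ω => Nat.find (hex n ω)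
  have hτm : ∀ n, Measurable[m] (τ n) := fun n => measurable_find _ fun k =>
    (measurableSet_le measurable_const (measurable_norm.comp (hψ k))).union hBm.compl
  have hτ : ∀ n : ℕ, ∀ ω ∈ B, ((n : ℝ) + 1) ≤ ‖ψ (τ n ω) ω‖ := fun n ω hω => by
    rcases Nat.find_spec (hex n ω) with h | h
    · exact (Nat.cast_succ n).symm.le.trans h
    · exact absurd hω h
  have hψτ : ∀ n, Measurable[m] fun ω => ψ (τ n ω) ω := fun n =>
    (measurable_from_prod_countable_right (f := fun p : ℕ × Ω => ψ p.1 p.2) hψ).comp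
      ((hτm n).prodMk measurable_id)
  set v : ℕ → Ω → (EuclideanSpace ℝ (Fin d)) := fun n => B.indicator fun ω => ‖ψ (τ n ω) ω‖⁻¹ • ψ (τ n ω) ω
  have hvm : ∀ n, Measurable[m] (v n) := fun n =>
    ((measurable_norm.comp (hψτ n)).inv.smul (hψτ n)).indicator hBm
  have hvB : ∀ n, ∀ ω ∈ B, ‖v n ω‖ = 1 := fun n ω hω => by
    have : (0 : ℝ) < ‖ψ (τ n ω) ω‖ := lt_of_lt_of_le (by positivity) (hτ n ω hω)
    simp only [v, indicator_of_mem hω, norm_smul, norm_inv, norm_norm]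
    exact inv_mul_cancel₀ this.ne'
  have hv1 : ∀ n ω, ‖v n ω‖ ≤ 1 := fun n ω => by
    by_cases hω : ω ∈ B
    · exact (hvB n ω hω).le
    · simp [v, hω]
  -- Convex combinations of unit vectors may cancel to zero. Weighting `v n` by the positive part of
  -- its component along each `± e_i` prevents this: the components of the weighted copies sum to
  -- `‖v n‖ ^ 2 = 1`, a linear relation that survives convex combinations and limits.
  let e : Fin d ⊕ Fin d → (EuclideanSpace ℝ (Fin d)) := 
    Sum.elim (fun i => EuclideanSpace.single i (1 : ℝ)) fun i => -EuclideanSpace.single i (1 : ℝ)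
  have he1 : ∀ u, ‖e u‖ = 1 := by rintro (i | i) <;> simp [e]
  have hesum : ∀ x : (EuclideanSpace ℝ (Fin d)), ∑ u, max (inner ℝ x (e u)) 0 * inner ℝ x (e u) = ‖x‖ ^ 2 := by
    intro x
    rw [Fintype.sum_sum_type, ← Finset.sum_add_distrib, EuclideanSpace.norm_sq_eq]
    refine Finset.sum_congr rfl fun i _ => ?_
    have h1 : inner ℝ x (EuclideanSpace.single i (1 : ℝ)) = x i := by
      simp [EuclideanSpace.inner_single_right]
    simp only [e, Sum.elim_inl, Sum.elim_inr, inner_neg_right, h1, Real.norm_eq_abs, sq_abs]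
    rcases le_total 0 (x i) with h | h
    · rw [max_eq_left h, max_eq_right (by linarith)]; ring
    · rw [max_eq_right h, max_eq_left (by linarith)]; ring
  set c : ℕ → (Fin d ⊕ Fin d) → Ω → ℝ := fun n u ω => max (inner ℝ (v n ω) (e u)) 0
  have hcm : ∀ n u, Measurable[m] (c n u) := fun n u =>
    (Measurable.inner (hvm n) measurable_const).max measurable_const
  have hc0 : ∀ n u ω, 0 ≤ c n u ω := fun n u ω => le_max_right _ _
  have hc1 : ∀ n u ω, c n u ω ≤ 1 := fun n u ω => by
    refine max_le ?_ zero_le_one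
    refine (real_inner_le_norm _ _).trans ?_
    rw [he1, mul_one]; exact hv1 n ω
  set f : ℕ → (Fin d ⊕ Fin d) → Ω → (EuclideanSpace ℝ (Fin d)) := fun n u ω => c n u ω • v n ω
  have hfm : ∀ n u, Measurable[m] (f n u) := fun n u => (hcm n u).smul (hvm n)
  obtain ⟨w, hw, hlim⟩ : ∃ w : ℕ → ℕ →₀ ℝ, (∀ n, w n ∈ tailWeights n) ∧ ∀ᵐ ω ∂P, ∀ u, ∃ l,
      Tendsto (fun n => Finsupp.linearCombination ℝ (fun k => f k u ω) (w n)) atTop (𝓝 l) := by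
    -- All directions are placed in one product space so that the same weights serve every `u`.
    set F : ℕ → Ω → PiLp 2 (fun _ : Fin d ⊕ Fin d => (EuclideanSpace ℝ (Fin d))) := fun n ω =>
      WithLp.toLp 2 fun u => f n u ω
    have hF : ∀ k, AEStronglyMeasurable (F k) P := fun k =>
      (PiLp.continuous_toLp 2 _).comp_aestronglyMeasurable
        (measurable_pi_lambda _ fun u => (hfm k u).mono hm le_rfl).aestronglyMeasurable
    obtain ⟨w, hw, hlim⟩ := exists_tailWeights_ae_tendsto (P := P) hF
      (ae_of_all _ fun ω => ⟨√(∑ _u : Fin d ⊕ Fin d, 1), fun k => by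
        rw [PiLp.norm_eq_of_L2]
        refine Real.sqrt_le_sqrt (Finset.sum_le_sum fun u _ => ?_)
        have : ‖f k u ω‖ ≤ 1 := by
          rw [norm_smul, Real.norm_of_nonneg (hc0 k u ω)]
          exact mul_le_one₀ (hc1 k u ω) (norm_nonneg _) (hv1 k ω)
        exact pow_le_one₀ (norm_nonneg _) this⟩)
    refine ⟨w, hw, hlim.mono fun ω ⟨l, hl⟩ u => ⟨l u, ?_⟩⟩
    refine (((PiLp.continuous_apply 2 _ u).tendsto l).comp hl).congr fun n => ?_
    simp [Finsupp.linearCombination_apply, Finsupp.sum, F]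
  have hlim' := fun u => exists_measurable_limit hm hnull
    (fun n => measurable_linearCombination (fun k => hfm k u) (w n))
    (hlim.mono fun ω h => h u)
  choose g hgm hg using hlim'
  have hgpos : ∀ u, ∀ᵐ ω ∂P, 0 ≤ inner ℝ (g u ω) (Y ω) := by
    intro u
    filter_upwards [hg u, hb] with ω hgω ⟨C, hC⟩
    -- Normalisation divides the lower bound on payoffs by a norm of at least `k + 1`, so limiting
    -- payoffs are nonnegative.
    have hC' : ∀ k : ℕ, -(|C| / ((k : ℝ) + 1)) ≤ inner ℝ (f k u ω) (Y ω) := by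
      intro k
      have hk : (0 : ℝ) < (k : ℝ) + 1 := by positivity
      by_cases hω : ω ∈ B
      · have hn : (0 : ℝ) < ‖ψ (τ k ω) ω‖ := hk.trans_le (hτ k ω hω)
        simp only [f, v, indicator_of_mem hω, inner_smul_left, smul_smul]
        have h1 : -|C| ≤ inner ℝ (ψ (τ k ω) ω) (Y ω) :=
          (neg_le_neg (le_abs_self C)).trans (hC _)
        have h2 : c k u ω * ‖ψ (τ k ω) ω‖⁻¹ ≤ ((k : ℝ) + 1)⁻¹ :=
          (mul_le_of_le_one_left (by positivity) (hc1 k u ω)).trans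
            (inv_anti₀ hk (hτ k ω hω))
        have h3 : 0 ≤ c k u ω * ‖ψ (τ k ω) ω‖⁻¹ := mul_nonneg (hc0 k u ω) (by positivity)
        have h4 := mul_le_mul_of_nonneg_left h1 h3
        have h5 := mul_le_mul_of_nonneg_right h2 (abs_nonneg C)
        simp only [conj_trivial]
        rw [div_eq_inv_mul]
        linarith
      · simp only [f, v, indicator_of_notMem hω, smul_zero, inner_zero_left]
        have : 0 ≤ |C| / ((k : ℝ) + 1) := by positivity
        linarith
    have hlow : ∀ n : ℕ, -(|C| * (1 / ((n : ℝ) + 1))) ≤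
        inner ℝ (Finsupp.linearCombination ℝ (fun k => f k u ω) (w n)) (Y ω) := fun n => by
      refine linearCombination_mem_of_tailWeights (K := {x | _ ≤ inner ℝ x (Y ω)})
        (convex_halfSpace_ge (f := fun x : (EuclideanSpace ℝ (Fin d)) => inner ℝ x (Y ω)) ⟨fun x y => inner_add_left x y _,
          fun a x => by simp [inner_smul_left]⟩ _) (fun k hk => ?_) (hw n)
      refine le_trans (neg_le_neg ?_) (hC' k)
      rw [mul_one_div]
      gcongr
    refine le_of_tendsto_of_tendsto' ?_ (hgω.inner tendsto_const_nhds) hlow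
    simpa using (tendsto_one_div_add_atTop_nhds_zero_nat.const_mul |C|).neg
  have hgN : ∀ u, g u ∈ annihilator P m Y := fun u => ⟨hgm u, hNA _ (hgm u) (hgpos u)⟩
  -- By absence of arbitrage `g u` is redundant, while as a limit of positions orthogonal to the
  -- annihilator it is orthogonal to itself.
  have hg0 : ∀ᵐ ω ∂P, ∀ u, g u ω = 0 := by
    refine ae_all_iff.2 fun u => ?_
    have ho : ∀ᵐ ω ∂P, ∀ n, inner ℝ (ψ n ω) (g u ω) = 0 :=
      ae_all_iff.2 fun n => horth n _ (hgN u)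
    filter_upwards [ho, hg u] with ω h1 h2
    have h3 : ∀ k, inner ℝ (f k u ω) (g u ω) = 0 := fun k => by
      by_cases hω : ω ∈ B
      · simp only [f, v, indicator_of_mem hω, inner_smul_left, h1, mul_zero]
      · simp only [f, v, indicator_of_notMem hω, smul_zero, inner_zero_left]
    have h4 : ∀ n,
        inner ℝ (Finsupp.linearCombination ℝ (fun k => f k u ω) (w n)) (g u ω) = 0 := fun n => by
      simp [Finsupp.linearCombination_apply, Finsupp.sum, sum_inner, inner_smul_left, h3]
    have h5 : Tendsto (fun n => inner ℝ
        (Finsupp.linearCombination ℝ (fun k => f k u ω) (w n)) (g u ω)) atTop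
        (𝓝 (inner ℝ (g u ω) (g u ω))) := h2.inner tendsto_const_nhds
    simp_rw [h4] at h5
    exact inner_self_eq_zero.1 (tendsto_nhds_unique h5 tendsto_const_nhds)
  have hg' : ∀ᵐ ω ∂P, ∀ u, Tendsto
      (fun n => Finsupp.linearCombination ℝ (fun k => f k u ω) (w n)) atTop (𝓝 (g u ω)) :=
    ae_all_iff.2 hg
  filter_upwards [hg0, hg'] with ω h0 hl
  by_cases hω : ω ∈ B
  · exfalso
    have h1 : ∀ n, ∑ u, inner ℝ (Finsupp.linearCombination ℝ (fun k => f k u ω) (w n)) (e u)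
        = 1 := fun n => by
      have h2 : ∀ k, ∑ u, inner ℝ (f k u ω) (e u) = 1 := fun k => by
        simp only [f, c, inner_smul_left, conj_trivial]
        rw [hesum, hvB k ω hω, one_pow]
      simp_rw [Finsupp.linearCombination_apply, Finsupp.sum, sum_inner, inner_smul_left,
        conj_trivial]
      rw [Finset.sum_comm]
      simp_rw [← Finset.mul_sum, h2, mul_one]
      exact (hw n).2.2
    have h3 : Tendsto (fun n => ∑ u,
        inner ℝ (Finsupp.linearCombination ℝ (fun k => f k u ω) (w n)) (e u)) atTop
        (𝓝 (∑ u, inner ℝ (g u ω) (e u))) :=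
      tendsto_finsetSum _ fun u _ => (hl u).inner tendsto_const_nhds
    simp_rw [h1, h0, inner_zero_left, Finset.sum_const_zero] at h3
    exact one_ne_zero (tendsto_nhds_unique tendsto_const_nhds h3)
  · simp only [B, mem_ofPred_eq, not_forall, not_exists, not_le] at hω
    obtain ⟨N, hN⟩ := hω
    exact ⟨N, fun n => (hN n).le⟩

instance isMarkovKernel_condLaw [IsFiniteMeasure P] (Y : Ω → EuclideanSpace ℝ (Fin d)) :
    IsMarkovKernel (condLaw P m Y) := by
  unfold condLaw; infer_instance

/-- The annihilator can only grow when the affine span of the support of the conditional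
distribution shrinks. -/
lemma annihilator_subset_of_affineSpan_support_le [IsProbabilityMeasure P] (hm : m ≤ m0)
    (hnull : ∀ A : Set Ω, P A = 0 → MeasurableSet[m] A) {Y Y' : Ω → EuclideanSpace ℝ (Fin d)} (hY : Measurable Y) (hY' : Measurable Y')
    (h : ∀ᵐ ω ∂P, affineSpan ℝ (condLaw P m Y' ω).support ≤
      affineSpan ℝ (condLaw P m Y ω).support) :
    annihilator P m Y ⊆ annihilator P m Y' := by
  rintro ν ⟨hν, hνY⟩
  refine ⟨hν, ?_⟩
  have hset : MeasurableSet[m.prod inferInstance]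
      {p : Ω × EuclideanSpace ℝ (Fin d) | inner ℝ (ν p.1) p.2 = 0} :=
    measurableSet_eq_fun (Measurable.inner (hν.comp measurable_fst) measurable_snd)
      measurable_const
  -- Disintegration: `ν` is orthogonal to `Z` exactly when almost every conditional law of `Z` is
  -- carried by the orthogonal complement of `ν ω`. That set is closed and affine, so it contains
  -- the affine span of the support.
  have key : ∀ Z : Ω → EuclideanSpace ℝ (Fin d), Measurable Z →
      ((∀ᵐ ω ∂P, inner ℝ (ν ω) (Z ω) = 0) ↔
        ∀ᵐ ω ∂P.trim hm, ∀ᵐ y ∂condLaw P m Z ω, inner ℝ (ν ω) y = 0) := by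
    intro Z hZ
    have hid : @Measurable Ω Ω m0 m id := measurable_id'' hm
    have hdis := @compProd_map_condDistrib Ω Ω (EuclideanSpace ℝ (Fin d)) _ _ _ m0 P _ id Z m
      hZ.aemeasurable
    rw [← trim_eq_map hm] at hdis
    have h1 := Measure.ae_compProd_iff (μ := P.trim hm) (κ := condLaw P m Z) hset
    rw [← h1]
    unfold condLaw
    rw [hdis, ae_map_iff (@Measurable.aemeasurable _ _ _ (m.prod inferInstance) _ _
      (@Measurable.prodMk Ω m0 Ω _ m _ _ _ hid hZ)) hset]
    rfl
  refine (key Y' hY').2 ?_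
  filter_upwards [(key Y hY).1 hνY, ae_trim_of_ae hm hnull h] with ω h1 h2
  set V := (LinearMap.ker (innerₛₗ ℝ (ν ω))).toAffineSubspace
  have hclosed : IsClosed {y : EuclideanSpace ℝ (Fin d) | inner ℝ (ν ω) y = 0} :=
    isClosed_eq (continuous_const.inner continuous_id) continuous_const
  have hV : affineSpan ℝ (condLaw P m Y ω).support ≤ V :=
    affineSpan_le.2 fun y hy => Measure.support_subset_of_isClosed hclosed h1 hy
  filter_upwards [Measure.support_mem_ae (μ := condLaw P m Y' ω)] with y hy
  exact hV (h2 (subset_affineSpan ℝ _ hy))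

end OneStep

end RobustUtility

/-! ### Wealth processes and convergent selections over several periods -/

namespace RobustUtility

variable {Ω : Type*} {d T : ℕ}

section Wealth

lemma wealth_convexCombination (S : PriceProcess Ω d T) (x : ℝ) (φ ψ : Portfolio Ω d T)
    {a b : ℝ} (hab : a + b = 1) (t : Fin (T + 1)) (ω : Ω) :
    wealth S x (a • φ + b • ψ) t ω = a * wealth S x φ t ω + b * wealth S x ψ t ω := by
  simp only [wealth, Pi.add_apply, Pi.smul_apply, inner_add_left, inner_smul_left, conj_trivial,
    Finset.sum_add_distrib, mul_add, Finset.mul_sum]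
  linear_combination -x * hab

lemma wealth_zero_portfolio (S : PriceProcess Ω d T) (x : ℝ) (t : Fin (T + 1)) (ω : Ω) :
    wealth S x 0 t ω = x := by
  simp [wealth]

lemma wealth_single (S : PriceProcess Ω d T) (x : ℝ) (s : Fin T)
    (ξ : Ω → EuclideanSpace ℝ (Fin d)) (t : Fin (T + 1)) (ω : Ω) :
    wealth S x (Pi.single s ξ) t ω
      = x + if s.castSucc < t then inner ℝ (ξ ω) (increment S s ω) else 0 := by
  unfold wealth
  congr 1
  rw [Finset.sum_filter, Finset.sum_eq_single s]
  · simp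
  · intro r _ hr
    simp [Pi.single_eq_of_ne hr]
  · simp

lemma wealth_update (S : PriceProcess Ω d T) (x : ℝ) (φ : Portfolio Ω d T) (s : Fin T)
    (ν : Ω → EuclideanSpace ℝ (Fin d)) (t : Fin (T + 1)) {ω : Ω}
    (h : inner ℝ (ν ω) (increment S s ω) = 0) :
    wealth S x (Function.update φ s fun ω => φ s ω - ν ω) t ω = wealth S x φ t ω := by
  unfold wealth
  congr 1
  refine Finset.sum_congr rfl fun r _ => ?_
  by_cases hr : r = s
  · subst hr
    simp [inner_sub_left, h]
  · rw [Function.update_of_ne hr]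

lemma wealth_succ (S : PriceProcess Ω d T) (x : ℝ) (φ : Portfolio Ω d T) (s : Fin T) (ω : Ω) :
    wealth S x φ s.succ ω
      = wealth S x φ s.castSucc ω + inner ℝ (φ s ω) (increment S s ω) := by
  classical
  have hfil : (Finset.univ.filter fun r : Fin T => r.castSucc < s.succ)
      = insert s (Finset.univ.filter fun r : Fin T => r.castSucc < s.castSucc) := by
    ext r
    simp only [Finset.mem_filter, Finset.mem_univ, true_and, Finset.mem_insert, Fin.lt_def,
      Fin.val_castSucc, Fin.val_succ, Fin.ext_iff]
    omega
  unfold wealth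
  rw [hfil, Finset.sum_insert (by simp)]
  ring

lemma tendsto_wealth (S : PriceProcess Ω d T) (x : ℝ) {φ : ℕ → Portfolio Ω d T}
    {ψ : Portfolio Ω d T} (t : Fin (T + 1)) {ω : Ω}
    (h : ∀ s : Fin T, s.castSucc < t → Tendsto (fun n => φ n s ω) atTop (𝓝 (ψ s ω))) :
    Tendsto (fun n => wealth S x (φ n) t ω) atTop (𝓝 (wealth S x ψ t ω)) :=
  tendsto_const_nhds.add <| tendsto_finsetSum _ fun s hs =>
    (h s (Finset.mem_filter.1 hs).2).inner tendsto_const_nhds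

end Wealth

variable [mΩ : MeasurableSpace Ω] {P : Measure Ω} {ℱ : Filtration (Fin (T + 1)) mΩ}

lemma measurable_increment {S : PriceProcess Ω d T} (hS : Adapted ℱ S) (s : Fin T) :
    Measurable (increment S s) :=
  ((hS s.succ).mono (ℱ.le _) le_rfl).sub ((hS s.castSucc).mono (ℱ.le _) le_rfl)

lemma measurable_wealth {S : PriceProcess Ω d T} (hS : Adapted ℱ S) (x : ℝ)
    {φ : Portfolio Ω d T} (hφ : IsPredictable ℱ φ) (t : Fin (T + 1)) :
    Measurable (wealth S x φ t) :=
  (Finset.measurable_sum _ fun s _ => Measurable.inner ((hφ s).mono (ℱ.le _) le_rfl)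
    (measurable_increment hS s)).const_add x

lemma convex_feasible (x : ℝ) (S : PriceProcess Ω d T) : Convex ℝ (feasible P ℱ x S) := by
  intro φ hφ ψ hψ a b ha hb hab
  refine ⟨fun s => ((hφ.1 s).const_smul a).add ((hψ.1 s).const_smul b), fun t => ?_⟩
  filter_upwards [hφ.2 t, hψ.2 t] with ω h1 h2
  rw [wealth_convexCombination S x φ ψ hab]
  positivity

lemma convex_admissible (𝒮 : Set (PriceProcess Ω d T)) (x : ℝ) :
    Convex ℝ (admissible P ℱ 𝒮 x) :=
  convex_iInter₂ fun S _ => convex_feasible x S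

lemma zero_mem_feasible {x : ℝ} (hx : 0 ≤ x) (S : PriceProcess Ω d T) :
    0 ∈ feasible P ℱ x S :=
  ⟨fun _ => measurable_const, fun t => ae_of_all _ fun ω => by rwa [wealth_zero_portfolio]⟩

/-- Absence of arbitrage entails absence of arbitrage over each single trading period. -/
lemma NoArbitrage.one_step {x : ℝ} (hx : 0 ≤ x) {S : PriceProcess Ω d T}
    (h : NoArbitrage P ℱ x S) (s : Fin T) {ξ : Ω → EuclideanSpace ℝ (Fin d)}
    (hξ : Measurable[ℱ s.castSucc] ξ)
    (hpos : ∀ᵐ ω ∂P, 0 ≤ inner ℝ (ξ ω) (increment S s ω)) :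
    ∀ᵐ ω ∂P, inner ℝ (ξ ω) (increment S s ω) = 0 := by
  have hlast : s.castSucc < Fin.last T := Fin.castSucc_lt_last s
  -- Trading in this period alone adds a nonnegative payoff to `x ≥ 0`, so the portfolio is feasible
  -- without rescaling.
  have := h (Pi.single s ξ) ⟨fun r => ?_, fun t => ?_⟩ ?_
  · filter_upwards [this] with ω hω
    simpa [wealth_single, hlast] using hω
  · by_cases hr : r = s
    · subst hr; simpa using hξ
    · rw [Pi.single_eq_of_ne hr]; exact measurable_const
  · filter_upwards [hpos] with ω hω
    rw [wealth_single]
    split_ifs <;> linarith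
  · filter_upwards [hpos] with ω hω
    simpa [wealth_single, hlast] using hω

/-- A decreasing sequence of convex sets of portfolios that are feasible in an arbitrage-free
model and that do not see redundant positions admits an almost surely convergent selection. -/
theorem exists_ae_tendsto_selection [IsProbabilityMeasure P]
    (hnull : ∀ (t : Fin (T + 1)) (A : Set Ω), P A = 0 → MeasurableSet[ℱ t] A)
    {S : PriceProcess Ω d T} {x : ℝ} (hx : 0 ≤ x)
    (hNA : NoArbitrage P ℱ x S) {K : ℕ → Set (Portfolio Ω d T)} (hanti : Antitone K)
    (hconv : ∀ n, Convex ℝ (K n)) (hne : ∀ n, (K n).Nonempty)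
    (hfeas : ∀ n, K n ⊆ feasible P ℱ x S)
    (hinv : ∀ n, ∀ φ ∈ K n, ∀ s, ∀ ν ∈ annihilator P (ℱ s.castSucc) (increment S s),
      Function.update φ s (fun ω => φ s ω - ν ω) ∈ K n) :
    ∃ φ : ℕ → Portfolio Ω d T, ∃ ψ : Portfolio Ω d T, (∀ n, φ n ∈ K n) ∧ IsPredictable ℱ ψ ∧
      ∀ᵐ ω ∂P, ∀ s, Tendsto (fun n => φ n s ω) atTop (𝓝 (ψ s ω)) := by
  -- Induction on the number of periods in which positions converge.
  have key : ∀ t : ℕ, t ≤ T → ∃ φ : ℕ → Portfolio Ω d T, (∀ n, φ n ∈ K n) ∧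
      ∀ s : Fin T, (s : ℕ) < t → ∀ᵐ ω ∂P, ∃ l, Tendsto (fun n => φ n s ω) atTop (𝓝 l) := by
    intro t
    induction t with
    | zero =>
      intro _
      choose φ hφ using hne
      exact ⟨φ, hφ, fun s hs => absurd hs (Nat.not_lt_zero _)⟩
    | succ t ih =>
      intro ht
      obtain ⟨φ, hφ, hlim⟩ := ih (Nat.le_of_succ_le ht)
      set s : Fin T := ⟨t, ht⟩
      have hm := ℱ.le s.castSucc
      choose ν hν horth using fun n => exists_mem_annihilator_orthogonal (P := P) hm
        (increment S s) ((hfeas n (hφ n)).1 s)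
      set φ' : ℕ → Portfolio Ω d T := fun n =>
        Function.update (φ n) s fun ω => φ n s ω - ν n ω
      have hφ' : ∀ n, φ' n ∈ K n := fun n => hinv n _ (hφ n) s _ (hν n)
      have hφs : ∀ n, φ' n s = fun ω => φ n s ω - ν n ω := fun n => Function.update_self ..
      have hlim' : ∀ r : Fin T, (r : ℕ) < t →
          ∀ᵐ ω ∂P, ∃ l, Tendsto (fun n => φ' n r ω) atTop (𝓝 l) := fun r hr => by
        have hrs : r ≠ s := fun h => by simp [h, s] at hr
        have e : ∀ n, φ' n r = φ n r := fun n => Function.update_of_ne hrs _ _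
        simpa only [e] using hlim r hr
      -- Wealth at the start of the period converges, so it is bounded above; wealth at its end is
      -- nonnegative, so the payoff is bounded below.
      have hlow : ∀ᵐ ω ∂P, ∃ c : ℝ, ∀ n, -c ≤ inner ℝ (φ' n s ω) (increment S s ω) := by
        have hl : ∀ᵐ ω ∂P, ∀ r : Fin T, (r : ℕ) < t →
            ∃ l, Tendsto (fun n => φ' n r ω) atTop (𝓝 l) :=
          ae_all_iff.2 fun r => by
            by_cases hr : (r : ℕ) < t
            · filter_upwards [hlim' r hr] with ω h _ using h
            · exact ae_of_all _ fun ω h => absurd h hr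
        have hw : ∀ᵐ ω ∂P, ∀ n, 0 ≤ wealth S x (φ' n) s.succ ω :=
          ae_all_iff.2 fun n => (hfeas n (hφ' n)).2 s.succ
        filter_upwards [hl, hw] with ω h1 h2
        have hwl : ∃ l, Tendsto (fun n => wealth S x (φ' n) s.castSucc ω) atTop (𝓝 l) := by
          classical
          choose l hl using h1
          -- With `ω` fixed, a constant portfolio carries the limits; later positions do not enter
          -- this wealth and are set to zero.
          refine ⟨_, tendsto_wealth S x (ψ := fun r _ => if h : (r : ℕ) < t then l r h else 0)
            s.castSucc fun r hr => ?_⟩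
          have hr' : (r : ℕ) < t := hr
          simp only [hr', dif_pos]
          exact hl r hr'
        obtain ⟨l, hl⟩ := hwl
        obtain ⟨c, hc⟩ := hl.bddAbove_range
        refine ⟨c, fun n => ?_⟩
        have h3 := h2 n
        rw [wealth_succ] at h3
        have h4 : wealth S x (φ' n) s.castSucc ω ≤ c := hc (mem_range_self n)
        linarith
      have hbdd := ae_bounded_of_payoff_bounded hm (hnull _)
        (fun ξ hξ hpos => hNA.one_step hx s hξ hpos) (fun n => (hfeas n (hφ' n)).1 s)
        (fun n ν' hν' => by rw [hφs]; exact horth n ν' hν') hlow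
      obtain ⟨w, hw, hlims⟩ := exists_tailWeights_ae_tendsto
        (fun n => (((hfeas n (hφ' n)).1 s).mono hm le_rfl).aestronglyMeasurable) hbdd
      -- Tail combinations stay in the nested convex sets and preserve the limits already obtained
      -- in earlier periods.
      refine ⟨fun n => Finsupp.linearCombination ℝ φ' (w n), fun n =>
        linearCombination_mem_of_tailWeights (hconv n) (fun k hk => hanti hk (hφ' k)) (hw n),
        fun r hr => ?_⟩
      simp only [linearCombination_apply_fun]
      rcases Nat.lt_succ_iff_lt_or_eq.1 hr with hr | hr
      · filter_upwards [hlim' r hr] with ω ⟨l, hl⟩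
        exact ⟨l, tendsto_linearCombination_tailWeights hl hw⟩
      · have : r = s := Fin.ext hr
        rw [this]; exact hlims
  obtain ⟨φ, hφ, hlim⟩ := key T le_rfl
  choose ψ hψ hl using fun s : Fin T => exists_measurable_limit (ℱ.le s.castSucc)
    (hnull s.castSucc) (fun n => (hfeas n (hφ n)).1 s) (hlim s s.2)
  exact ⟨φ, ψ, hφ, hψ, ae_all_iff.2 hl⟩

end RobustUtility

/-! ### Expected loss and its minimisation -/

namespace RobustUtility

variable {Ω : Type*} {d T : ℕ}

/-- The distance of the utility below the level `L`. -/
noncomputable def loss (U : ℝ → EReal) (L : ℝ) (y : ℝ) : ℝ≥0∞ := ((L : EReal) - U y).toENNReal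

/-- Since `L` is finite, subtraction from `L` is an order-reversing involution of `EReal`; it
exchanges infima of utilities with suprema of losses. -/
lemma le_coe_sub_comm (L : ℝ) (a b : EReal) : a ≤ (L : EReal) - b ↔ b ≤ (L : EReal) - a := by
  induction a <;> induction b <;> simp [← EReal.coe_sub]
  constructor <;> intro h <;> linarith

lemma IsUtility.antitone_loss {U : ℝ → EReal} (hU : IsUtility U) (L : ℝ) :
    Antitone (loss U L) := fun _ _ h =>
  EReal.toENNReal_le_toENNReal (EReal.sub_le_sub le_rfl (hU.mono h))

lemma IsUtility.lowerSemicontinuous_loss {U : ℝ → EReal} (hU : IsUtility U) (L : ℝ) :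
    LowerSemicontinuous (loss U L) := by
  have hc : Continuous fun u : EReal => ((L : EReal) - u).toENNReal := by
    refine EReal.continuous_toENNReal.comp (continuous_iff_continuousAt.2 fun u => ?_)
    change ContinuousAt (fun v : EReal => (L : EReal) + -v) u
    exact (EReal.continuousAt_add (Or.inl (EReal.coe_ne_top L)) (Or.inl (EReal.coe_ne_bot L))).comp
      (continuousAt_const.prodMk continuous_neg.continuousAt)
  exact hc.comp_upperSemicontinuous_antitone hU.usc fun u v h =>
    EReal.toENNReal_le_toENNReal (EReal.sub_le_sub le_rfl h)

lemma IsUtility.loss_convex {U : ℝ → EReal} (hU : IsUtility U) {L : ℝ} (hL : ∀ y, U y ≤ L)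
    {a b : ℝ} (ha : 0 ≤ a) (hb : 0 ≤ b) (hab : a + b = 1) (y z : ℝ) :
    loss U L (a * y + b * z) ≤ ENNReal.ofReal a * loss U L y + ENNReal.ofReal b * loss U L z := by
  rcases ha.eq_or_lt with rfl | ha
  · obtain rfl : b = 1 := by linarith
    simp
  rcases hb.eq_or_lt with rfl | hb
  · obtain rfl : a = 1 := by linarith
    simp
  have hconc := hU.concave y z a b ha hb hab
  have ha' : ENNReal.ofReal a ≠ 0 := by simpa using ha
  have hb' : ENNReal.ofReal b ≠ 0 := by simpa using hb
  have h1 := hL y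
  have h2 := hL z
  have h3 := hL (a * y + b * z)
  unfold loss
  generalize U y = p at *
  generalize U z = q at *
  generalize U (a * y + b * z) = r at *
  induction p with
  | bot => simp [ENNReal.mul_top ha']
  | top => simp at h1
  | coe p =>
  induction q with
  | bot => simp [ENNReal.mul_top hb']
  | top => simp at h2
  | coe q =>
  induction r with
  | bot => simp [← EReal.coe_mul, ← EReal.coe_add] at hconc
  | top => simp at h3
  | coe r =>
  norm_cast at h1 h2 h3 hconc
  simp only [← EReal.coe_sub, EReal.toENNReal_of_ne_top (EReal.coe_ne_top _), EReal.toReal_coe]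
  rw [← ENNReal.ofReal_mul ha.le, ← ENNReal.ofReal_mul hb.le,
    ← ENNReal.ofReal_add (mul_nonneg ha.le (by linarith)) (mul_nonneg hb.le (by linarith))]
  refine ENNReal.ofReal_le_ofReal ?_
  linear_combination hconc - L * hab

variable [mΩ : MeasurableSpace Ω] {P : Measure Ω} {ℱ : Filtration (Fin (T + 1)) mΩ}

/-- The expectation of an extended random variable that is bounded above. -/
lemma expectation_eq_sub_lintegral [IsProbabilityMeasure P] {X : Ω → EReal} (hX : Measurable X)
    {L : ℝ} (hL0 : 0 ≤ L) (hL : ∀ ω, X ω ≤ L) :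
    expectation P X = (L : EReal) - ((∫⁻ ω, ((L : EReal) - X ω).toENNReal ∂P : ℝ≥0∞) : EReal) := by
  -- Every term is nonnegative, so this form of `X = X⁺ - X⁻` integrates without any integrability
  -- assumption. The positive part has integral at most `L`, which excludes `∞ - ∞`.
  have hpt : ∀ ω, ((L : EReal) - X ω).toENNReal + (X ω).toENNReal
      = ENNReal.ofReal L + (-X ω).toENNReal := by
    intro ω
    have h := hL ω
    generalize X ω = u at h
    induction u with
    | bot => simp
    | top => simp at h
    | coe u =>
      norm_cast at h
      simp only [← EReal.coe_sub, ← EReal.coe_neg,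
        EReal.toENNReal_of_ne_top (EReal.coe_ne_top _), EReal.toReal_coe]
      rcases le_total 0 u with hu | hu
      · rw [← ENNReal.ofReal_add (by linarith) hu, ENNReal.ofReal_of_nonpos (p := -u) (by linarith)]
        simp
      · rw [ENNReal.ofReal_of_nonpos hu, ← ENNReal.ofReal_add hL0 (by linarith), add_zero,
          sub_eq_add_neg]
  have hXp : Measurable fun ω => (X ω).toENNReal :=
    EReal.continuous_toENNReal.measurable.comp hX
  have hint := lintegral_congr (μ := P) hpt
  rw [lintegral_add_right _ hXp, lintegral_add_left measurable_const, lintegral_const,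
    measure_univ, mul_one] at hint
  have hfin : ∫⁻ ω, (X ω).toENNReal ∂P ≠ ⊤ := by
    refine ne_top_of_le_ne_top (ENNReal.ofReal_ne_top (r := L)) ?_
    calc ∫⁻ ω, (X ω).toENNReal ∂P ≤ ∫⁻ _, ENNReal.ofReal L ∂P := lintegral_mono fun ω => by
          simpa using EReal.toENNReal_le_toENNReal (hL ω)
      _ = ENNReal.ofReal L := by simp
  unfold expectation
  generalize ∫⁻ ω, (X ω).toENNReal ∂P = A at *
  generalize ∫⁻ ω, (-X ω).toENNReal ∂P = B at *
  generalize ∫⁻ ω, ((L : EReal) - X ω).toENNReal ∂P = I at *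
  lift A to NNReal using hfin
  induction B with
  | top =>
    have : I = ⊤ := by simpa using hint
    simp [this]
  | coe B =>
  lift I to NNReal using fun h => by
    rw [h] at hint; simp at hint
    exact ENNReal.add_ne_top.2 ⟨ENNReal.ofReal_ne_top, ENNReal.coe_ne_top⟩ hint.symm
  lift L to NNReal using hL0
  rw [ENNReal.ofReal_coe_nnreal] at hint
  norm_cast at hint
  have h : (I : ℝ) + A = L + B := by exact_mod_cast hint
  have h' : (A : ℝ) - B = L - I := by linarith
  simp only [EReal.coe_nnreal_eq_coe_real, ← EReal.coe_sub, h']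

/-- The largest expected loss of the portfolio over the family of models. -/
noncomputable def worstCaseLoss (P : Measure Ω) (𝒮 : Set (PriceProcess Ω d T)) (U : ℝ → EReal)
    (L x : ℝ) (φ : Portfolio Ω d T) : ℝ≥0∞ :=
  ⨆ S ∈ 𝒮, ∫⁻ ω, loss U L (wealth S x φ (Fin.last T) ω) ∂P

section Optimal

variable {𝒮 : Set (PriceProcess Ω d T)} {U : ℝ → EReal} {L x : ℝ}

lemma IsUtility.measurable_loss_wealth (hU : IsUtility U) (L x : ℝ) {S : PriceProcess Ω d T}
    (hS : Adapted ℱ S) {φ : Portfolio Ω d T} (hφ : IsPredictable ℱ φ) :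
    Measurable fun ω => loss U L (wealth S x φ (Fin.last T) ω) :=
  (hU.antitone_loss L).measurable.comp (measurable_wealth hS x hφ _)

lemma IsUtility.expectation_eq (hU : IsUtility U) [IsProbabilityMeasure P] (hL0 : 0 ≤ L)
    (hL : ∀ y, U y ≤ L) {S : PriceProcess Ω d T} (hS : Adapted ℱ S) {φ : Portfolio Ω d T}
    (hφ : IsPredictable ℱ φ) :
    expectation P (fun ω => U (wealth S x φ (Fin.last T) ω))
      = (L : EReal) - ((∫⁻ ω, loss U L (wealth S x φ (Fin.last T) ω) ∂P : ℝ≥0∞) : EReal) :=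
  expectation_eq_sub_lintegral (hU.mono.measurable.comp (measurable_wealth hS x hφ _)) hL0
    fun _ => hL _

lemma IsUtility.worstCaseUtility_eq (hU : IsUtility U) [IsProbabilityMeasure P]
    (hadapted : ∀ S ∈ 𝒮, Adapted ℱ S) (hne : 𝒮.Nonempty) (hL0 : 0 ≤ L) (hL : ∀ y, U y ≤ L)
    {φ : Portfolio Ω d T} (hφ : IsPredictable ℱ φ) :
    worstCaseUtility P 𝒮 U x φ = (L : EReal) - (worstCaseLoss P 𝒮 U L x φ : EReal) := by
  have he := fun S (hS : S ∈ 𝒮) =>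
    hU.expectation_eq (P := P) (x := x) hL0 hL (hadapted S hS) hφ
  apply le_antisymm
  · have hle : ∀ S ∈ 𝒮, worstCaseUtility P 𝒮 U x φ ≤ (L : EReal) -
        ((∫⁻ ω, loss U L (wealth S x φ (Fin.last T) ω) ∂P : ℝ≥0∞) : EReal) := fun S hS => by
      rw [← he S hS]; exact iInf₂_le S hS
    -- A model is needed here: over an empty family the worst-case utility would be `⊤` instead of
    -- `L`.
    obtain ⟨S₀, hS₀⟩ := hne
    have h0 : (0 : EReal) ≤ (L : EReal) - worstCaseUtility P 𝒮 U x φ :=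
      (EReal.coe_ennreal_nonneg _).trans ((le_coe_sub_comm L _ _).1 (hle S₀ hS₀))
    rw [le_coe_sub_comm, ← EReal.coe_toENNReal h0, EReal.coe_ennreal_le_coe_ennreal_iff]
    refine iSup₂_le fun S hS => ?_
    rw [← EReal.coe_ennreal_le_coe_ennreal_iff, EReal.coe_toENNReal h0]
    exact (le_coe_sub_comm L _ _).1 (hle S hS)
  · refine le_iInf₂ fun S hS => ?_
    rw [he S hS]
    exact EReal.sub_le_sub le_rfl (EReal.coe_ennreal_le_coe_ennreal_iff.2
      (le_iSup₂ (f := fun S (_ : S ∈ 𝒮) => ∫⁻ ω, loss U L (wealth S x φ (Fin.last T) ω) ∂P) S hS))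

lemma IsUtility.convex_worstCaseLoss_le (hU : IsUtility U) (hadapted : ∀ S ∈ 𝒮, Adapted ℱ S)
    (hL : ∀ y, U y ≤ L) (r : ℝ≥0∞) :
    Convex ℝ {φ | IsPredictable ℱ φ ∧ worstCaseLoss P 𝒮 U L x φ ≤ r} := by
  intro φ hφ ψ hψ a b ha hb hab
  refine ⟨fun s => ((hφ.1 s).const_smul a).add ((hψ.1 s).const_smul b), iSup₂_le fun S hS => ?_⟩
  have hr : ∀ χ : Portfolio Ω d T, worstCaseLoss P 𝒮 U L x χ ≤ r →
      ∫⁻ ω, loss U L (wealth S x χ (Fin.last T) ω) ∂P ≤ r := fun χ h =>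
    (le_iSup₂ (f := fun S (_ : S ∈ 𝒮) =>
      ∫⁻ ω, loss U L (wealth S x χ (Fin.last T) ω) ∂P) S hS).trans h
  have hm := hU.measurable_loss_wealth L x (hadapted S hS) hφ.1
  have hm' := hU.measurable_loss_wealth L x (hadapted S hS) hψ.1
  calc ∫⁻ ω, loss U L (wealth S x (a • φ + b • ψ) (Fin.last T) ω) ∂P
      ≤ ∫⁻ ω, (ENNReal.ofReal a * loss U L (wealth S x φ (Fin.last T) ω)
          + ENNReal.ofReal b * loss U L (wealth S x ψ (Fin.last T) ω)) ∂P :=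
        lintegral_mono fun ω => by
          simp only [wealth_convexCombination S x φ ψ hab]
          exact hU.loss_convex hL ha hb hab _ _
    _ = ENNReal.ofReal a * ∫⁻ ω, loss U L (wealth S x φ (Fin.last T) ω) ∂P
          + ENNReal.ofReal b * ∫⁻ ω, loss U L (wealth S x ψ (Fin.last T) ω) ∂P := by
        rw [lintegral_add_left (hm.const_mul _), lintegral_const_mul _ hm,
          lintegral_const_mul _ hm']
    _ ≤ ENNReal.ofReal a * r + ENNReal.ofReal b * r := by
        gcongr
        exacts [hr φ hφ.2, hr ψ hψ.2]
    _ = r := by rw [← add_mul, ← ENNReal.ofReal_add ha hb, hab, ENNReal.ofReal_one, one_mul]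

lemma worstCaseLoss_zero [IsProbabilityMeasure P] :
    worstCaseLoss P 𝒮 U L x 0 ≤ loss U L x :=
  iSup₂_le fun S _ => by simp [wealth_zero_portfolio]

lemma zero_mem_admissible (hx : 0 ≤ x) : 0 ∈ admissible P ℱ 𝒮 x :=
  mem_iInter₂.2 fun S _ => zero_mem_feasible hx S

/-- Removing a position that is redundant in every model of the family changes neither
admissibility nor the losses. -/
lemma update_mem_admissible_of_annihilator {φ : Portfolio Ω d T} {r : ℝ≥0∞}
    (hφ : φ ∈ admissible P ℱ 𝒮 x) (hr : worstCaseLoss P 𝒮 U L x φ ≤ r) (s : Fin T)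
    {ν : Ω → EuclideanSpace ℝ (Fin d)}
    (hν : ∀ S ∈ 𝒮, ν ∈ annihilator P (ℱ s.castSucc) (increment S s)) :
    Function.update φ s (fun ω => φ s ω - ν ω) ∈ admissible P ℱ 𝒮 x ∧
      worstCaseLoss P 𝒮 U L x (Function.update φ s fun ω => φ s ω - ν ω) ≤ r := by
  have hw : ∀ S ∈ 𝒮, ∀ t, ∀ᵐ ω ∂P,
      wealth S x (Function.update φ s fun ω => φ s ω - ν ω) t ω = wealth S x φ t ω :=
    fun S hS t => (hν S hS).2.mono fun ω h => wealth_update S x φ s ν t h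
  refine ⟨mem_iInter₂.2 fun S hS => ⟨fun q => ?_, fun t => ?_⟩, ?_⟩
  · have hφS := (mem_iInter₂.1 hφ S hS).1
    by_cases hq : q = s
    · subst hq
      rw [Function.update_self]
      exact (hφS q).sub (hν S hS).1
    · rw [Function.update_of_ne hq]
      exact hφS q
  · filter_upwards [hw S hS t, (mem_iInter₂.1 hφ S hS).2 t] with ω h1 h2
    rwa [h1]
  · refine le_trans (iSup₂_mono fun S hS => le_of_eq (lintegral_congr_ae ?_)) hr
    filter_upwards [hw S hS (Fin.last T)] with ω h
    rw [h]

/-- Feasibility and bounds on the losses pass to almost sure limits. -/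
lemma IsUtility.mem_admissible_of_tendsto (hU : IsUtility U) (hadapted : ∀ S ∈ 𝒮, Adapted ℱ S)
    {φ : ℕ → Portfolio Ω d T} {ψ : Portfolio Ω d T} (hφ : ∀ n, φ n ∈ admissible P ℱ 𝒮 x)
    (hψ : IsPredictable ℱ ψ)
    (hlim : ∀ᵐ ω ∂P, ∀ s, Tendsto (fun n => φ n s ω) atTop (𝓝 (ψ s ω)))
    {r : ℕ → ℝ≥0∞} {c : ℝ≥0∞} (hr : ∀ n, worstCaseLoss P 𝒮 U L x (φ n) ≤ r n)
    (hrc : Tendsto r atTop (𝓝 c)) :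
    ψ ∈ admissible P ℱ 𝒮 x ∧ worstCaseLoss P 𝒮 U L x ψ ≤ c := by
  have hφ' := fun n S hS => mem_iInter₂.1 (hφ n) S hS
  refine ⟨mem_iInter₂.2 fun S hS => ⟨hψ, fun t => ?_⟩, iSup₂_le fun S hS => ?_⟩
  · have h0 : ∀ᵐ ω ∂P, ∀ n, 0 ≤ wealth S x (φ n) t ω := ae_all_iff.2 fun n => (hφ' n S hS).2 t
    filter_upwards [hlim, h0] with ω h1 h2
    exact ge_of_tendsto' (tendsto_wealth S x t fun s _ => h1 s) h2
  · calc ∫⁻ ω, loss U L (wealth S x ψ (Fin.last T) ω) ∂P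
        ≤ ∫⁻ ω, liminf (fun n => loss U L (wealth S x (φ n) (Fin.last T) ω)) atTop ∂P := by
          refine lintegral_mono_ae (hlim.mono fun ω h => ?_)
          have h1 := tendsto_wealth S x (Fin.last T) fun s _ => h s
          -- Lower semicontinuity of the loss replaces continuity, since `U` may jump at the edge of
          -- its domain; Fatou's lemma does the rest.
          refine le_trans ((hU.lowerSemicontinuous_loss L).le_liminf _) ?_
          exact liminf_le_liminf_of_le h1
      _ ≤ liminf (fun n => ∫⁻ ω, loss U L (wealth S x (φ n) (Fin.last T) ω) ∂P) atTop :=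
          lintegral_liminf_le fun n =>
            hU.measurable_loss_wealth L x (hadapted S hS) (hφ' n S hS).1
      _ ≤ liminf r atTop := liminf_le_liminf (Eventually.of_forall fun n =>
          (le_iSup₂ (f := fun S (_ : S ∈ 𝒮) =>
            ∫⁻ ω, loss U L (wealth S x (φ n) (Fin.last T) ω) ∂P) S hS).trans (hr n))
      _ = c := hrc.liminf_eq

/-- The worst-case loss attains its infimum over the admissible portfolios. -/
theorem exists_minimal_worstCaseLoss [IsProbabilityMeasure P]
    (hnull : ∀ (t : Fin (T + 1)) (A : Set Ω), P A = 0 → MeasurableSet[ℱ t] A)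
    (hadapted : ∀ S ∈ 𝒮, Adapted ℱ S) (hx : 0 ≤ x)
    (hNA : (arbitrageFreeModels P ℱ 𝒮 x).Nonempty) (hU : IsUtility U) (hL : ∀ y, U y ≤ L)
    (hfin : loss U L x ≠ ⊤) :
    ∃ φ ∈ admissible P ℱ 𝒮 x, ∀ ψ ∈ admissible P ℱ 𝒮 x,
      worstCaseLoss P 𝒮 U L x φ ≤ worstCaseLoss P 𝒮 U L x ψ := by
  obtain ⟨S, hS, hNAS, hsupp⟩ := hNA
  set c := ⨅ φ ∈ admissible P ℱ 𝒮 x, worstCaseLoss P 𝒮 U L x φ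
  have hc : c < ⊤ := ((iInf₂_le 0 (zero_mem_admissible hx)).trans worstCaseLoss_zero).trans_lt
    hfin.lt_top
  -- The levels lie strictly above the infimum, so every sublevel set is nonempty.
  obtain ⟨r, hranti, hr, hrc⟩ := exists_seq_strictAnti_tendsto' hc
  set K : ℕ → Set (Portfolio Ω d T) := fun n =>
    {φ | φ ∈ admissible P ℱ 𝒮 x ∧ worstCaseLoss P 𝒮 U L x φ ≤ r n}
  have hpred : ∀ φ ∈ admissible P ℱ 𝒮 x, IsPredictable ℱ φ := fun φ hφ =>
    (mem_iInter₂.1 hφ S hS).1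
  obtain ⟨φ, ψ, hφ, hψ, hlim⟩ := exists_ae_tendsto_selection (K := K) hnull hx hNAS
    (fun i j hij φ hφ => ⟨hφ.1, hφ.2.trans (hranti.antitone hij)⟩)
    (fun n => by
      have h := (convex_admissible (P := P) (ℱ := ℱ) 𝒮 x).inter
        (hU.convex_worstCaseLoss_le (P := P) (x := x) hadapted hL (r n))
      convert h using 1
      ext φ
      exact ⟨fun hφ => ⟨hφ.1, hpred φ hφ.1, hφ.2⟩, fun hφ => ⟨hφ.1, hφ.2.2⟩⟩)
    (fun n => by
      obtain ⟨φ, hφ⟩ := iInf_lt_iff.1 (hr n).1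
      obtain ⟨hφ, h⟩ := iInf_lt_iff.1 hφ
      exact ⟨φ, hφ, h.le⟩)
    (fun n φ hφ => mem_iInter₂.1 hφ.1 S hS)
    -- Here the inclusion of affine supports enters: a position redundant in `S` is redundant in
    -- every `S'`.
    (fun n φ hφ s ν hν => update_mem_admissible_of_annihilator hφ.1 hφ.2 s fun S' hS' =>
      annihilator_subset_of_affineSpan_support_le (ℱ.le _) (hnull _)
        (measurable_increment (hadapted S hS) s) (measurable_increment (hadapted S' hS') s)
        (hsupp S' hS' s) hν)
  obtain ⟨h1, h2⟩ := hU.mem_admissible_of_tendsto hadapted (fun n => (hφ n).1) hψ hlim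
    (fun n => (hφ n).2) hrc
  exact ⟨ψ, h1, fun χ hχ => h2.trans (iInf₂_le χ hχ)⟩

end Optimal

end RobustUtility

/-! ### From minimal loss to maximal utility -/

theorem mainTheorem1 {Ω : Type*} [mΩ : MeasurableSpace Ω] (P : Measure Ω) [IsProbabilityMeasure P]
    (d T : ℕ) (ℱ : Filtration (Fin (T + 1)) mΩ)
    (hnull : ∀ (t : Fin (T + 1)) (A : Set Ω), P A = 0 → MeasurableSet[ℱ t] A)
    (𝒮 : Set (RobustUtility.PriceProcess Ω d T)) (hadapted : ∀ S ∈ 𝒮, Adapted ℱ S)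
    (x : ℝ) (hx : 0 < x)
    (hNA : (RobustUtility.arbitrageFreeModels P ℱ 𝒮 x).Nonempty)
    (U : ℝ → EReal) (hU : RobustUtility.IsUtility U)
    (hdom : interior (RobustUtility.effDom U) = Ioi 0)
    (hbdd : ∃ L : ℝ, Tendsto U atTop (𝓝 (L : EReal))) :
    ∃ φ ∈ RobustUtility.admissible P ℱ 𝒮 x,
      RobustUtility.robustValue P ℱ 𝒮 U x = RobustUtility.worstCaseUtility P 𝒮 U x φ ∧
      ⊥ < RobustUtility.robustValue P ℱ 𝒮 U x ∧
      RobustUtility.robustValue P ℱ 𝒮 U x < ⊤ := by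
  obtain ⟨L, hL0, hL⟩ : ∃ L : ℝ, 0 ≤ L ∧ ∀ y, U y ≤ L := by
    obtain ⟨L, hL⟩ := hbdd
    exact ⟨max L 0, le_max_right _ _, fun y =>
      (hU.mono.ge_of_tendsto hL y).trans (EReal.coe_le_coe_iff.2 (le_max_left _ _))⟩
  -- Since `x > 0` lies in the effective domain, holding nothing has finite loss in all models at
  -- once.
  have hfin : RobustUtility.loss U L x ≠ ⊤ := by
    have hxm : x ∈ interior (RobustUtility.effDom U) := hdom ▸ hx
    have hxU : x ∈ RobustUtility.effDom U := interior_subset hxm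
    have hxU : ⊥ < U x := hxU
    lift U x to ℝ using ⟨hU.ne_top x, hxU.ne'⟩ with u hu
    rw [RobustUtility.loss, ← hu, ← EReal.coe_sub,
      EReal.toENNReal_of_ne_top (EReal.coe_ne_top _)]
    exact ENNReal.ofReal_ne_top
  have hne : 𝒮.Nonempty := hNA.mono fun S hS => hS.1
  have heq : ∀ φ ∈ RobustUtility.admissible P ℱ 𝒮 x,
      RobustUtility.worstCaseUtility P 𝒮 U x φ
        = (L : EReal) - (RobustUtility.worstCaseLoss P 𝒮 U L x φ : EReal) := fun φ hφ =>
    hU.worstCaseUtility_eq hadapted hne hL0 hL (mem_iInter₂.1 hφ _ hne.some_mem).1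
  obtain ⟨φ, hφ, hmin⟩ := RobustUtility.exists_minimal_worstCaseLoss hnull hadapted hx.le hNA
    hU hL hfin
  have hval : RobustUtility.robustValue P ℱ 𝒮 U x
      = RobustUtility.worstCaseUtility P 𝒮 U x φ := by
    refine le_antisymm (iSup₂_le fun ψ hψ => ?_) (le_iSup₂ (f := fun φ
      (_ : φ ∈ RobustUtility.admissible P ℱ 𝒮 x) =>
        RobustUtility.worstCaseUtility P 𝒮 U x φ) φ hφ)
    rw [heq ψ hψ, heq φ hφ]
    exact EReal.sub_le_sub le_rfl (EReal.coe_ennreal_le_coe_ennreal_iff.2 (hmin ψ hψ))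
  have hlt : RobustUtility.worstCaseLoss P 𝒮 U L x φ ≠ ⊤ :=
    ne_top_of_le_ne_top hfin ((hmin 0 (RobustUtility.zero_mem_admissible hx.le)).trans
      RobustUtility.worstCaseLoss_zero)
  refine ⟨φ, hφ, hval, ?_, ?_⟩ <;> rw [hval, heq φ hφ] <;>
    lift RobustUtility.worstCaseLoss P 𝒮 U L x φ to NNReal using hlt with q
  · exact EReal.bot_lt_coe (L - q)
  · exact EReal.coe_lt_top (L - q)
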